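/- For an integer $n\ge 0$ let $\mathcal A$ be the real Clifford algebra with unit $e_0=1$ and generators $e_1,\dots,e_n$ satisfying $e_i^2=-1$ and $e_ie_j=-e_je_i$ for $i\neq j$. It has the basis $e_A=e_{h_1}\cdots e_{h_r}$, indexed by the subsets $A=\{h_1<\dots<h_r\}$ of $\{1,\dots,n\}$ (with $e_\emptyset=1$). For $\lambda=\sum_A\lambda_Ae_A\in\mathcal A$ put $|\lambda|_0^2=2^n\sum_A\lambda_A^2$. For $\Omega\subseteq\mathbb R^{n+1}$ let $L^2(\Omega,\mathcal A)$ be the space of functions $f=\sum_A f_Ae_A$ on $\Omega$ whose components $f_A$ are all square integrable on $\Omega$ with respect to Lebesgue measure, and let $C_0^\infty(\Omega,\mathcal A)$ be the space of functions $\alpha=\sum_A\alpha_Ae_A$ whose components $\alpha_A$ are smooth real functions on $\mathbb R^{n+1}$ with compact support contained in $\Omega$. Write points as $x=(x_0,\dots,x_n)$, let $\overline D=\sum_{i=0}^n e_i\partial_{x_i}$, and let it act from the right by $\alpha\overline D=\sum_{i,A}e_Ae_i\,\partial_{x_i}\alpha_A$. For $f,u\in L^2(\Omega,\mathcal A)$,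 $u$ is a weak solution of $\overline Du=f$ in $\Omega$ if $$\int_\Omega \alpha f\,dx=-\int_\Omega(\alpha\overline D)u\,dx\qquad\text{for all }\alpha\in C_0^\infty(\Omega,\mathcal A).$$ **Theorem.** (i) For all real $a<b$ there is a constant $c(a,b)>0$, depending only on $a$ and $b$, such that for every $n$, with $\Omega_0=\{x\in\mathbb R^{n+1}: a\le x_0\le b\}$, every $f\in L^2(\Omega_0,\mathcal A)$ admits a weak solution $u\in L^2(\Omega_0,\mathcal A)$ of $\overline Du=f$ in $\Omega_0$ with $$\int_{\Omega_0}|u|_0^2\,dx\le 2^{2n}\,c(a,b)\int_{\Omega_0}|f|_0^2\,dx .$$ (ii) Consequently, for every $n$, every bounded open set $\Omega\subset\mathbb R^{n+1}$ and every $f\in L^2(\Omega,\mathcal A)$, there is a weak solution $u\in L^2(\Omega,\mathcal A)$ of $\overline Du=f$ in $\Omega$. -/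

import Mathlib

open MeasureTheory
open scoped ContDiff

noncomputable section

namespace CliffordDirac

/-- The negative definite quadratic form `v ↦ -∑ i, v i ^ 2` on `ℝⁿ`. -/
def negForm (n : ℕ) : QuadraticForm ℝ (Fin n → ℝ) :=
  QuadraticMap.weightedSumSquares ℝ (fun _ : Fin n => (-1 : ℝ))

/-- The real Clifford algebra `𝒜` with unit `e₀ = 1` and generators `e₁, …, eₙ` subject to
`eᵢ ^ 2 = -1` and `eᵢ eⱼ = - eⱼ eᵢ` for `i ≠ j`; its real dimension is `2 ^ n`. -/
abbrev Cl (n : ℕ) : Type := CliffordAlgebra (negForm n)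

/-- The generator `e_{i+1}`, for `i : Fin n`. -/
def gen (n : ℕ) (i : Fin n) : Cl n := CliffordAlgebra.ι (negForm n) (Pi.single i 1)

/-- The family `e₀ = 1, e₁, …, eₙ`. -/
def eVec (n : ℕ) : Fin (n + 1) → Cl n := Fin.cons 1 (gen n)

/-- `e_A = e_{h₁} ⋯ e_{h_r}`, where `h₁ < ⋯ < h_r` are the elements of `A`; `e_∅ = 1`. -/
def blade (n : ℕ) (A : Finset (Fin n)) : Cl n := ((A.sort (· ≤ ·)).map (gen n)).prod

theorem negForm_apply (n : ℕ) (v : Fin n → ℝ) : negForm n v = -∑ i, v i * v i := by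
  simp [negForm, QuadraticMap.weightedSumSquares_apply]

theorem gen_mul_self (n : ℕ) (i : Fin n) : gen n i * gen n i = -1 := by
  rw [gen, CliffordAlgebra.ι_sq_scalar, negForm_apply]
  simp [Pi.single_apply]

theorem associated_neg_single (n : ℕ) {i j : Fin n} (h : i ≠ j) :
    QuadraticMap.associated (R := ℝ) (-negForm n) (Pi.single i 1) (Pi.single j 1) = 0 := by
  rw [QuadraticMap.associated_apply]
  simp only [neg_apply, negForm_apply, Pi.add_apply, mul_add, add_mul,
    Finset.sum_add_distrib]
  simp [Pi.single_apply, h, h.symm]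

theorem gen_mul_gen (n : ℕ) {i j : Fin n} (h : i ≠ j) :
    gen n i * gen n j + gen n j * gen n i = 0 := by
  rw [gen, gen, CliffordAlgebra.ι_mul_ι_add_swap, QuadraticMap.polar]
  simp only [negForm_apply, Pi.add_apply, mul_add, add_mul, Finset.sum_add_distrib]
  simp [Pi.single_apply, h, h.symm]

theorem contractLeft_wedge (n : ℕ) (d : Module.Dual ℝ (Fin n → ℝ)) (l : List (Fin n))
    (hl : ∀ j ∈ l, d (Pi.single j 1) = 0) :
    CliffordAlgebra.contractLeft d
      ((l.map fun j => ExteriorAlgebra.ι ℝ (Pi.single j (1 : ℝ) : Fin n → ℝ)).prod) = 0 := by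
  induction l with
  | nil => simp
  | cons j l ih =>
    rw [List.map_cons, List.prod_cons]
    refine (CliffordAlgebra.contractLeft_ι_mul (Q := (0 : QuadraticForm ℝ _)) (d := d) _ _).trans ?_
    rw [ih fun k hk => hl k (List.mem_cons_of_mem _ hk), hl j List.mem_cons_self]
    simp

theorem equivExterior_prod (n : ℕ) (l : List (Fin n)) (hl : l.Nodup) :
    CliffordAlgebra.equivExterior (negForm n) ((l.map (gen n)).prod) =
      (l.map fun j => ExteriorAlgebra.ι ℝ (Pi.single j (1 : ℝ) : Fin n → ℝ)).prod := by
  induction l with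
  | nil => exact CliffordAlgebra.changeForm_one CliffordAlgebra.changeForm.associated_neg_proof
  | cons j l ih =>
    rw [List.nodup_cons] at hl
    rw [List.map_cons, List.prod_cons, List.map_cons, List.prod_cons]
    refine (CliffordAlgebra.changeForm_ι_mul CliffordAlgebra.changeForm.associated_neg_proof _ _).trans ?_
    have h1 := ih hl.2
    change CliffordAlgebra.changeForm CliffordAlgebra.changeForm.associated_neg_proof _ = _ at h1
    rw [h1, contractLeft_wedge]
    · simp [ExteriorAlgebra.ι]
    · intro k hk
      exact associated_neg_single n (fun h => hl.1 (h ▸ hk))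

theorem equivExterior_blade (n : ℕ) (A : Finset (Fin n)) :
    CliffordAlgebra.equivExterior (negForm n) (blade n A) =
      (Pi.basisFun ℝ (Fin n)).ExteriorAlgebra A := by
  rw [blade, equivExterior_prod n _ (Finset.sort_nodup _ _),
    ExteriorAlgebra.basis_apply_ofCard (s_card := rfl)]
  rw [ExteriorAlgebra.ιMulti_family, ExteriorAlgebra.ιMulti_apply]
  rw [Set.powersetCard.ofFinEmbEquiv_symm_apply, ← Finset.listMap_orderEmbOfFin_finRange A rfl,
    List.map_map, ← List.ofFn_eq_map]
  simp [Function.comp_def]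

theorem bladeBasis_aux (n : ℕ) :
    blade n = ((Pi.basisFun ℝ (Fin n)).ExteriorAlgebra.map
      (CliffordAlgebra.equivExterior (negForm n)).symm) := by
  funext A
  rw [Module.Basis.map_apply, ← equivExterior_blade, LinearEquiv.symm_apply_apply]

/-- The elements `e_A`, `A ⊆ {1, …, n}`, form a basis of `𝒜` over `ℝ`. -/
def bladeBasis (n : ℕ) : Module.Basis (Finset (Fin n)) ℝ (Cl n) :=
  Module.Basis.mk (v := blade n)
    (by rw [bladeBasis_aux]; exact Module.Basis.linearIndependent _)
    (by rw [bladeBasis_aux]; exact (Module.Basis.span_eq _).ge)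

/-- The coefficient `[a]_A = a_A` in `a = ∑_A a_A e_A`. -/
def coef {n : ℕ} (A : Finset (Fin n)) (a : Cl n) : ℝ := (bladeBasis n).repr a A

/-- The norm `|a|₀ = (2 ^ n ∑_A a_A ^ 2) ^ (1/2)`. -/
def norm0 {n : ℕ} (a : Cl n) : ℝ := Real.sqrt (2 ^ n * ∑ A : Finset (Fin n), coef A a ^ 2)

/-- Points `x = (x₀, x₁, …, xₙ)` of `ℝ^{n+1}`. -/
abbrev Pt (n : ℕ) : Type := EuclideanSpace ℝ (Fin (n + 1))

/-- `L²(Ω, 𝒜)` for Lebesgue measure: every component `f_A` is square integrable on `Ω`.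
Functions are given on all of `ℝ^{n+1}`; only their values on `Ω` matter. -/
def MemL2 {n : ℕ} (Ω : Set (Pt n)) (f : Pt n → Cl n) : Prop :=
  ∀ A : Finset (Fin n), MemLp (fun x => coef A (f x)) 2 (volume.restrict Ω)

/-- `C₀^∞(Ω, 𝒜)`: every component `α_A` is smooth with compact support contained in `Ω`. -/
def IsTestFunction {n : ℕ} (Ω : Set (Pt n)) (α : Pt n → Cl n) : Prop :=
  ∀ A : Finset (Fin n), ContDiff ℝ ∞ (fun x => coef A (α x)) ∧
    HasCompactSupport (fun x => coef A (α x)) ∧ tsupport (fun x => coef A (α x)) ⊆ Ω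

/-- The partial derivative `∂g/∂x_i` of a real function. -/
def partialDeriv {n : ℕ} (i : Fin (n + 1)) (g : Pt n → ℝ) (x : Pt n) : ℝ :=
  fderiv ℝ g x (EuclideanSpace.single i 1)

/-- The right action `α D̄ = ∑_{i,A} e_A e_i ∂_{x_i} α_A` of `D̄ = ∑_{i=0}^n e_i ∂_{x_i}`. -/
def rightDirac {n : ℕ} (α : Pt n → Cl n) (x : Pt n) : Cl n :=
  ∑ i : Fin (n + 1), ∑ A : Finset (Fin n),
    partialDeriv i (fun y => coef A (α y)) x • (blade n A * eVec n i)

/-- The integral over `Ω` of an `𝒜`-valued function, `∑_A (∫_Ω g_A dx) e_A`. -/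
def integralOn {n : ℕ} (Ω : Set (Pt n)) (g : Pt n → Cl n) : Cl n :=
  ∑ A : Finset (Fin n), (∫ x in Ω, coef A (g x)) • blade n A

/-- `u` solves `D̄ u = f` weakly in `Ω`: `∫_Ω α f dx = - ∫_Ω (α D̄) u dx` for every
`α ∈ C₀^∞(Ω, 𝒜)`. (Used for `f` and `u` in `L²(Ω, 𝒜)`, so that both integrals exist.) -/
def IsWeakSolution {n : ℕ} (Ω : Set (Pt n)) (u f : Pt n → Cl n) : Prop :=
  ∀ α : Pt n → Cl n, IsTestFunction Ω α →
    integralOn Ω (fun x => α x * f x) = -integralOn Ω (fun x => rightDirac α x * u x)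

/-- The slab `{x ∈ ℝ^{n+1} : a ≤ x₀ ≤ b}`. -/
def slab (n : ℕ) (a b : ℝ) : Set (Pt n) := {x | a ≤ x 0 ∧ x 0 ≤ b}

end CliffordDirac

end

open CliffordDirac

noncomputable section

namespace CliffordDirac

/-! ### Products of generators -/

theorem bladeBasis_apply (n : ℕ) (A : Finset (Fin n)) : bladeBasis n A = blade n A := by
  simp [bladeBasis]

theorem sum_coef_smul_blade {n : ℕ} (a : Cl n) :
    ∑ A : Finset (Fin n), coef A a • blade n A = a := by
  simpa [coef, bladeBasis_apply] using (bladeBasis n).sum_repr a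

theorem coef_blade {n : ℕ} (A B : Finset (Fin n)) :
    coef A (blade n B) = if A = B then 1 else 0 := by
  rw [coef, ← bladeBasis_apply, Module.Basis.repr_self, Finsupp.single_apply]
  simp [eq_comm]

theorem coef_add {n : ℕ} (A : Finset (Fin n)) (a b : Cl n) :
    coef A (a + b) = coef A a + coef A b := by
  simp [coef]

theorem coef_smul {n : ℕ} (A : Finset (Fin n)) (r : ℝ) (a : Cl n) :
    coef A (r • a) = r * coef A a := by
  simp [coef]

theorem coef_zero {n : ℕ} (A : Finset (Fin n)) : coef A (0 : Cl n) = 0 := by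
  simp [coef]

theorem coef_sum {n : ℕ} {ι : Type*} (A : Finset (Fin n)) (s : Finset ι) (g : ι → Cl n) :
    coef A (∑ i ∈ s, g i) = ∑ i ∈ s, coef A (g i) := by
  simp [coef]

/-- Reordering a product of generators changes it at most by a sign. -/
theorem prod_gen_perm {n : ℕ} {l l' : List (Fin n)} (h : l.Perm l') :
    ∃ ε : ℝ, ε * ε = 1 ∧ (l.map (gen n)).prod = ε • (l'.map (gen n)).prod := by
  induction h with
  | nil => exact ⟨1, by simp⟩
  | cons x _ ih =>
    obtain ⟨ε, hε, h⟩ := ih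
    exact ⟨ε, hε, by simp [h]⟩
  | swap x y l =>
    by_cases hxy : x = y
    · exact ⟨1, by simp [hxy]⟩
    · refine ⟨-1, by norm_num, ?_⟩
      have h := eq_neg_of_add_eq_zero_left (gen_mul_gen n (Ne.symm hxy))
      simp only [List.map_cons, List.prod_cons, ← mul_assoc, h]
      simp
  | trans _ _ ih₁ ih₂ =>
    obtain ⟨ε, hε, h⟩ := ih₁
    obtain ⟨δ, hδ, h'⟩ := ih₂
    exact ⟨ε * δ, by linear_combination (δ * δ) * hε + hδ, by rw [h, h', smul_smul]⟩

theorem blade_mul_gen {n : ℕ} (A : Finset (Fin n)) (i : Fin n) :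
    ∃ ε : ℝ, ε * ε = 1 ∧ blade n A * gen n i = ε • blade n (symmDiff A {i}) := by
  by_cases hi : i ∈ A
  · have hp : (A.sort (· ≤ ·)).Perm ((A.erase i).sort (· ≤ ·) ++ [i]) := by
      refine (List.perm_ext_iff_of_nodup (Finset.sort_nodup _ _) ?_).2 ?_
      · simpa [List.nodup_append, Finset.sort_nodup] using fun a h _ => h
      · intro j
        by_cases hj : j = i <;> simp [hj, hi]
    obtain ⟨ε, hε, h⟩ := prod_gen_perm hp
    have hs : symmDiff A {i} = A.erase i := by
      ext j
      by_cases hj : j = i <;> simp [Finset.mem_symmDiff, hj, hi]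
    refine ⟨-ε, by simpa using hε, ?_⟩
    rw [hs, blade, h]
    simp [mul_assoc, gen_mul_self, blade]
  · have hp : (A.sort (· ≤ ·) ++ [i]).Perm ((insert i A).sort (· ≤ ·)) := by
      refine (List.perm_ext_iff_of_nodup ?_ (Finset.sort_nodup _ _)).2 ?_
      · simpa [List.nodup_append, Finset.sort_nodup] using fun (a : Fin n) ha (h : a = i) => hi (h ▸ ha)
      · intro j
        simp [or_comm]
    obtain ⟨ε, hε, h⟩ := prod_gen_perm hp
    have hs : symmDiff A {i} = insert i A := by
      ext j
      by_cases hj : j = i <;> simp [Finset.mem_symmDiff, hj, hi]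
    refine ⟨ε, hε, ?_⟩
    rw [hs, blade, blade, ← h]
    simp

theorem star_gen (n : ℕ) (i : Fin n) : star (gen n i) = -gen n i := by
  simp [gen]

theorem star_prod_gen {n : ℕ} (l : List (Fin n)) :
    ∃ ε : ℝ, ε * ε = 1 ∧ star (l.map (gen n)).prod = ε • (l.reverse.map (gen n)).prod := by
  induction l with
  | nil => exact ⟨1, by simp⟩
  | cons i l ih =>
    obtain ⟨ε, hε, h⟩ := ih
    refine ⟨-ε, by simpa using hε, ?_⟩
    rw [List.map_cons, List.prod_cons, star_mul, h, star_gen]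
    simp

theorem star_blade {n : ℕ} (A : Finset (Fin n)) :
    ∃ ε : ℝ, ε * ε = 1 ∧ star (blade n A) = ε • blade n A := by
  obtain ⟨ε, hε, h⟩ := star_prod_gen (A.sort (· ≤ ·))
  obtain ⟨δ, hδ, h'⟩ := prod_gen_perm (List.reverse_perm (A.sort (· ≤ ·)))
  exact ⟨ε * δ, by linear_combination (δ * δ) * hε + hδ, by rw [blade, h, h', smul_smul]⟩

/-! ### The inner product for which the blades are orthonormal -/

/-- The coordinates of `a` in the basis of blades, as a vector of a Euclidean space. -/
def coords (n : ℕ) : Cl n ≃ₗ[ℝ] EuclideanSpace ℝ (Finset (Fin n)) :=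
  (bladeBasis n).equivFun.trans (WithLp.linearEquiv 2 ℝ _).symm

theorem coords_apply {n : ℕ} (a : Cl n) (A : Finset (Fin n)) : coords n a A = coef A a := rfl

/-- The inner product `∑ A, a_A b_A` on the Clifford algebra, as a bilinear form. -/
def ip (n : ℕ) : Cl n →ₗ[ℝ] Cl n →ₗ[ℝ] ℝ :=
  (innerₗ (EuclideanSpace ℝ (Finset (Fin n)))).compl₁₂ (coords n).toLinearMap
    (coords n).toLinearMap

theorem ip_eq_inner {n : ℕ} (a b : Cl n) : ip n a b = inner ℝ (coords n a) (coords n b) := rfl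

theorem ip_eq_sum {n : ℕ} (a b : Cl n) : ip n a b = ∑ A, coef A a * coef A b := by
  simp [ip_eq_inner, PiLp.inner_apply, coords_apply, mul_comm]

theorem ip_comm {n : ℕ} (a b : Cl n) : ip n a b = ip n b a := by
  simp [ip_eq_sum, mul_comm]

theorem ip_blade_left {n : ℕ} (A : Finset (Fin n)) (b : Cl n) : ip n (blade n A) b = coef A b := by
  simp [ip_eq_sum, coef_blade]

theorem ip_blade_blade {n : ℕ} (A B : Finset (Fin n)) :
    ip n (blade n A) (blade n B) = if A = B then 1 else 0 := by
  rw [ip_blade_left, coef_blade]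

theorem blade_empty (n : ℕ) : blade n ∅ = 1 := by
  simp [blade]

theorem ip_one_left {n : ℕ} (b : Cl n) : ip n 1 b = coef ∅ b := by
  rw [← blade_empty, ip_blade_left]

/-- A linear map carrying the blades, up to signs, injectively to blades is an isometry. -/
theorem ip_map_map {n : ℕ} (T : Cl n →ₗ[ℝ] Cl n) (σ : Finset (Fin n) → Finset (Fin n))
    (hσ : Function.Injective σ)
    (hT : ∀ A, ∃ ε : ℝ, ε * ε = 1 ∧ T (blade n A) = ε • blade n (σ A)) (a b : Cl n) :
    ip n (T a) (T b) = ip n a b := by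
  have key : (ip n).compl₁₂ T T = ip n := by
    refine LinearMap.ext_basis (bladeBasis n) (bladeBasis n) fun A B => ?_
    obtain ⟨ε, hε, hA⟩ := hT A
    obtain ⟨δ, -, hB⟩ := hT B
    simp only [LinearMap.compl₁₂_apply, bladeBasis_apply, hA, hB, map_smul,
      LinearMap.smul_apply, ip_blade_blade, smul_eq_mul, hσ.eq_iff]
    by_cases h : A = B
    · subst h
      have : ε • blade n (σ A) = δ • blade n (σ A) := hA.symm.trans hB
      have h' : ε = δ := by
        have := congrArg (coef (σ A)) this
        simpa [coef_smul, coef_blade] using this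
      simp [← h', hε]
    · simp [h]
  exact LinearMap.congr_fun₂ key a b

theorem ip_mul_gen_mul_gen {n : ℕ} (i : Fin n) (a b : Cl n) :
    ip n (a * gen n i) (b * gen n i) = ip n a b :=
  ip_map_map (LinearMap.mulRight ℝ (gen n i)) (fun A => symmDiff A {i})
    (symmDiff_left_injective _) (fun A => blade_mul_gen A i) a b

theorem ip_mul_gen_left {n : ℕ} (i : Fin n) (a b : Cl n) :
    ip n (a * gen n i) b = -ip n a (b * gen n i) := by
  rw [← ip_mul_gen_mul_gen i (a * gen n i) b, mul_assoc, gen_mul_self]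
  simp

theorem ip_star_star {n : ℕ} (a b : Cl n) : ip n (star a) (star b) = ip n a b :=
  ip_map_map ((CliffordAlgebra.reverse (Q := negForm n)).comp
      (CliffordAlgebra.involute (Q := negForm n)).toLinearMap) id
    Function.injective_id star_blade a b

theorem ip_mul_blade_left {n : ℕ} (A : Finset (Fin n)) (a b : Cl n) :
    ip n (a * blade n A) b = ip n a (b * star (blade n A)) := by
  rw [blade]
  generalize A.sort (· ≤ ·) = l
  induction l generalizing a b with
  | nil => simp
  | cons i l ih =>
    rw [List.map_cons, List.prod_cons, ← mul_assoc, ih, star_mul, star_gen, ip_mul_gen_left,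
      ← mul_assoc]
    simp

theorem ip_mul_left {n : ℕ} (a b c : Cl n) : ip n (a * c) b = ip n a (b * star c) := by
  rw [← sum_coef_smul_blade c]
  simp only [Finset.mul_sum, mul_smul_comm, map_sum, map_smul, LinearMap.sum_apply,
    LinearMap.smul_apply, ip_mul_blade_left, star_sum, CliffordAlgebra.star_smul]

/-- The scalar part of a product. -/
theorem coef_empty_mul {n : ℕ} (a b : Cl n) : coef ∅ (a * b) = ip n a (star b) := by
  rw [← ip_one_left, ip_comm, ip_mul_left, one_mul]

theorem eVec_succ (n : ℕ) (i : Fin n) : eVec n i.succ = gen n i := rfl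

theorem eVec_zero (n : ℕ) : eVec n 0 = 1 := rfl

theorem ip_mul_eVec_self {n : ℕ} (i : Fin (n + 1)) (a b : Cl n) :
    ip n (a * eVec n i) (b * eVec n i) = ip n a b := by
  cases i using Fin.cases with
  | zero => simp [eVec_zero]
  | succ i => exact ip_mul_gen_mul_gen i a b

theorem ip_mul_eVec_swap {n : ℕ} {i j : Fin (n + 1)} (h : i ≠ j) (a b : Cl n) :
    ip n (a * eVec n i) (b * eVec n j) = -ip n (a * eVec n j) (b * eVec n i) := by
  cases i using Fin.cases with
  | zero =>
    cases j using Fin.cases with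
    | zero => exact absurd rfl h
    | succ j => simp [eVec_zero, eVec_succ, ip_mul_gen_left]
  | succ i =>
    cases j using Fin.cases with
    | zero => simp [eVec_zero, eVec_succ, ip_mul_gen_left]
    | succ j =>
      have hij : j ≠ i := fun e => h (by rw [e])
      rw [eVec_succ, eVec_succ, ip_mul_gen_left, ip_mul_gen_left, mul_assoc, mul_assoc,
        eq_neg_of_add_eq_zero_left (gen_mul_gen n hij)]
      simp

theorem eq_zero_of_coef_empty_blade_mul {n : ℕ} {c : Cl n}
    (h : ∀ B, coef ∅ (blade n B * c) = 0) : c = 0 := by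
  have h' : star c = 0 := by
    rw [← sum_coef_smul_blade (star c)]
    refine Finset.sum_eq_zero fun B _ => ?_
    rw [← ip_blade_left, ← coef_empty_mul, h, zero_smul]
  simpa using h'

/-! ### Integral identities for real test functions -/

theorem contDiff_partialDeriv {n : ℕ} (i : Fin (n + 1)) {g : Pt n → ℝ} (hg : ContDiff ℝ ∞ g) :
    ContDiff ℝ ∞ (partialDeriv i g) :=
  (hg.fderiv_right (m := ∞) (by simp)).clm_apply contDiff_const

theorem support_partialDeriv_subset {n : ℕ} (i : Fin (n + 1)) (g : Pt n → ℝ) :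
    Function.support (partialDeriv i g) ⊆ tsupport g := by
  intro x hx
  refine support_fderiv_subset ℝ (f := g) fun h => hx ?_
  simp [partialDeriv, h]

theorem hasCompactSupport_partialDeriv {n : ℕ} (i : Fin (n + 1)) {g : Pt n → ℝ}
    (hg : HasCompactSupport g) : HasCompactSupport (partialDeriv i g) :=
  hg.mono' (support_partialDeriv_subset i g)

theorem partialDeriv_add {n : ℕ} (i : Fin (n + 1)) {g h : Pt n → ℝ} (hg : ContDiff ℝ ∞ g)
    (hh : ContDiff ℝ ∞ h) (x : Pt n) :
    partialDeriv i (fun y => g y + h y) x = partialDeriv i g x + partialDeriv i h x := by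
  simp only [partialDeriv]
  rw [fderiv_fun_add (hg.differentiable (by simp) x) (hh.differentiable (by simp) x)]
  rfl

theorem partialDeriv_const_mul {n : ℕ} (i : Fin (n + 1)) {g : Pt n → ℝ} (hg : ContDiff ℝ ∞ g)
    (r : ℝ) (x : Pt n) :
    partialDeriv i (fun y => r * g y) x = r * partialDeriv i g x := by
  simp only [partialDeriv]
  rw [fderiv_const_mul (hg.differentiable (by simp) x)]
  rfl

theorem partialDeriv_sum {n : ℕ} {ι : Type*} (i : Fin (n + 1)) (s : Finset ι)
    {g : ι → Pt n → ℝ} (hg : ∀ k ∈ s, ContDiff ℝ ∞ (g k)) (x : Pt n) :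
    partialDeriv i (fun y => ∑ k ∈ s, g k y) x = ∑ k ∈ s, partialDeriv i (g k) x := by
  simp only [partialDeriv]
  rw [fderiv_fun_sum fun k hk => (hg k hk).differentiable (by simp) x]
  simp

theorem partialDeriv_comm {n : ℕ} (i j : Fin (n + 1)) {g : Pt n → ℝ} (hg : ContDiff ℝ ∞ g)
    (x : Pt n) :
    partialDeriv i (partialDeriv j g) x = partialDeriv j (partialDeriv i g) x := by
  have hd : DifferentiableAt ℝ (fderiv ℝ g) x :=
    (hg.fderiv_right (m := ∞) (by simp)).differentiable (by simp) x
  have key (k l : Fin (n + 1)) : partialDeriv k (partialDeriv l g) x =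
      fderiv ℝ (fderiv ℝ g) x (EuclideanSpace.single k 1) (EuclideanSpace.single l 1) := by
    change fderiv ℝ (fun y => fderiv ℝ g y (EuclideanSpace.single l 1)) x _ = _
    rw [fderiv_clm_apply hd (differentiableAt_const _)]
    simp
  rw [key, key]
  exact (hg.contDiffAt.isSymmSndFDerivAt
    (by simpa using ENat.LEInfty.out)).eq _ _

theorem integral_mul_partialDeriv {n : ℕ} (i : Fin (n + 1)) {g h : Pt n → ℝ}
    (hg : ContDiff ℝ ∞ g) (hh : ContDiff ℝ ∞ h) (hhc : HasCompactSupport h) :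
    ∫ x, g x * partialDeriv i h x = -∫ x, partialDeriv i g x * h x := by
  refine integral_mul_fderiv_eq_neg_fderiv_mul_of_integrable
    (Continuous.integrable_of_hasCompactSupport ?_ ?_)
    (Continuous.integrable_of_hasCompactSupport ?_ ?_)
    (Continuous.integrable_of_hasCompactSupport ?_ ?_)
    (fun x _ => hg.differentiable (by simp) x) (fun x _ => hh.differentiable (by simp) x)
  · exact (contDiff_partialDeriv i hg).continuous.mul hh.continuous
  · exact hhc.mul_left
  · exact hg.continuous.mul (contDiff_partialDeriv i hh).continuous
  · exact (hasCompactSupport_partialDeriv i hhc).mul_left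
  · exact hg.continuous.mul hh.continuous
  · exact hhc.mul_left

theorem integral_partialDeriv_mul_partialDeriv_swap {n : ℕ} (i j : Fin (n + 1)) {g h : Pt n → ℝ}
    (hg : ContDiff ℝ ∞ g) (hh : ContDiff ℝ ∞ h) (hhc : HasCompactSupport h) :
    ∫ x, partialDeriv i g x * partialDeriv j h x =
      ∫ x, partialDeriv j g x * partialDeriv i h x := by
  rw [integral_mul_partialDeriv j (contDiff_partialDeriv i hg) hh hhc,
    integral_mul_partialDeriv i (contDiff_partialDeriv j hg) hh hhc]
  simp_rw [partialDeriv_comm i j hg]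

/-- The Poincaré inequality on a slab. -/
theorem integral_sq_le_of_tsupport_subset_slab {n : ℕ} {a b : ℝ} {g : Pt n → ℝ}
    (hg : ContDiff ℝ ∞ g) (hgc : HasCompactSupport g) (hs : tsupport g ⊆ slab n a b) :
    ∫ x, g x ^ 2 ≤ (2 * (b - a)) ^ 2 * ∫ x, partialDeriv 0 g x ^ 2 := by
  have hcont := hg.continuous
  have hd := contDiff_partialDeriv 0 hg
  have hdc := hasCompactSupport_partialDeriv 0 hgc
  have hφ : ContDiff ℝ ∞ fun x : Pt n => x 0 - a := by fun_prop
  have hφd (x : Pt n) : partialDeriv 0 (fun x : Pt n => x 0 - a) x = 1 := by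
    have : HasFDerivAt (fun x : Pt n => x 0 - a)
        (EuclideanSpace.proj (0 : Fin (n + 1)) : Pt n →L[ℝ] ℝ) x :=
      (EuclideanSpace.proj (0 : Fin (n + 1)) : Pt n →L[ℝ] ℝ).hasFDerivAt.sub_const a
    simp [partialDeriv, this.fderiv]
  have hgd (x : Pt n) : partialDeriv 0 (fun y => g y * g y) x = 2 * (g x * partialDeriv 0 g x) := by
    have h := hg.differentiable (by simp) x
    simp only [partialDeriv]
    rw [fderiv_fun_mul h h]
    simp
    ring
  have key := integral_mul_partialDeriv 0 hφ (hg.mul hg) hgc.mul_left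
  simp only [hφd, hgd, one_mul] at key
  have hi1 : Integrable fun x => g x ^ 2 := by
    simp_rw [pow_two]
    exact (hcont.mul hcont).integrable_of_hasCompactSupport hgc.mul_left
  have hi2 : Integrable fun x => partialDeriv 0 g x ^ 2 := by
    simp_rw [pow_two]
    exact (hd.continuous.mul hd.continuous).integrable_of_hasCompactSupport hdc.mul_left
  have hi3 : Integrable fun x : Pt n => (x 0 - a) * (2 * (g x * partialDeriv 0 g x)) :=
    (hφ.continuous.mul (continuous_const.mul
      (hcont.mul hd.continuous))).integrable_of_hasCompactSupport hdc.mul_left.mul_left.mul_left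
  have hpt (x : Pt n) : -((x 0 - a) * (2 * (g x * partialDeriv 0 g x))) ≤
      1 / 2 * g x ^ 2 + 2 * (b - a) ^ 2 * partialDeriv 0 g x ^ 2 := by
    by_cases hx : x ∈ tsupport g
    · obtain ⟨h1, h2⟩ := hs hx
      have h3 : (x 0 - a) ^ 2 ≤ (b - a) ^ 2 := by
        apply pow_le_pow_left₀ <;> linarith
      nlinarith [sq_nonneg (g x + 2 * (x 0 - a) * partialDeriv 0 g x),
        mul_le_mul_of_nonneg_right h3 (sq_nonneg (partialDeriv 0 g x))]
    · have : partialDeriv 0 g x = 0 := by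
        by_contra h
        exact hx (support_partialDeriv_subset 0 g h)
      simp [this, sq_nonneg]
  have hle := integral_mono hi3.neg ((hi1.const_mul (1 / 2)).add (hi2.const_mul (2 * (b - a) ^ 2)))
    hpt
  simp only [Pi.neg_apply, Pi.add_apply] at hle
  rw [integral_neg, integral_add (hi1.const_mul _) (hi2.const_mul _), integral_const_mul,
    integral_const_mul, key] at hle
  simp_rw [← pow_two] at hle
  linarith

/-! ### Solving an equation in a Hilbert space by duality -/

/-- If `‖S α‖ ≤ C ‖T α‖`, then the functional `T α ↦ -⟪S α, w⟫` is represented by a vector of norm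
at most `C ‖w‖`. -/
theorem exists_inner_eq_neg_inner_of_norm_le {V H : Type*} [AddCommGroup V] [Module ℝ V]
    [NormedAddCommGroup H] [InnerProductSpace ℝ H] [CompleteSpace H] (S T : V →ₗ[ℝ] H) {C : ℝ}
    (hC : 0 ≤ C) (hST : ∀ α, ‖S α‖ ≤ C * ‖T α‖) (w : H) :
    ∃ v : H, ‖v‖ ≤ C * ‖w‖ ∧ ∀ α, inner ℝ (T α) v = -inner ℝ (S α) w := by
  let l : V →ₗ[ℝ] ℝ := -((innerₗ H w).comp S)
  have hl (α : V) : l α = -inner ℝ w (S α) := rfl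
  have hbound (α : V) : ‖l α‖ ≤ C * ‖w‖ * ‖T α‖ := by
    rw [hl, norm_neg]
    refine (norm_inner_le_norm _ _).trans ?_
    nlinarith [mul_le_mul_of_nonneg_left (hST α) (norm_nonneg w)]
  have hker : LinearMap.ker T ≤ LinearMap.ker l := by
    intro α hα
    have h := hbound α
    rw [LinearMap.mem_ker.1 hα, norm_zero, mul_zero] at h
    exact norm_le_zero_iff.1 h
  let q : LinearMap.range T →ₗ[ℝ] ℝ :=
    ((LinearMap.ker T).liftQ l hker).comp T.quotKerEquivRange.symm.toLinearMap
  have hq (α : V) : q ⟨T α, α, rfl⟩ = l α := by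
    have : T.quotKerEquivRange.symm ⟨T α, α, rfl⟩ = (LinearMap.ker T).mkQ α := by
      rw [LinearEquiv.symm_apply_eq]
      rfl
    simp [q, this]
  obtain ⟨g, hg, hgn⟩ := exists_extension_norm_eq (LinearMap.range T)
    (q.mkContinuous (C * ‖w‖) (by
      rintro ⟨_, α, rfl⟩
      rw [hq]
      exact hbound α))
  refine ⟨(InnerProductSpace.toDual ℝ H).symm g, ?_, fun α => ?_⟩
  · rw [LinearIsometryEquiv.norm_map, hgn]
    exact LinearMap.mkContinuous_norm_le _ (by positivity) _
  · rw [real_inner_comm, InnerProductSpace.toDual_symm_apply, hg ⟨T α, α, rfl⟩,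
      LinearMap.mkContinuous_apply, hq, hl, real_inner_comm]

/-! ### Square integrable functions with values in the Clifford algebra -/

theorem memL2_iff {n : ℕ} {Ω : Set (Pt n)} {g : Pt n → Cl n} :
    MemL2 Ω g ↔ MemLp (fun x => coords n (g x)) 2 (volume.restrict Ω) :=
  (memLp_piLp_iff (f := fun x => coords n (g x))).symm

/-- The class in `L²` of a square integrable function with values in the Clifford algebra. -/
def MemL2.toL2 {n : ℕ} {Ω : Set (Pt n)} {g : Pt n → Cl n} (hg : MemL2 Ω g) :
    Lp (EuclideanSpace ℝ (Finset (Fin n))) 2 (volume.restrict Ω) :=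
  (memL2_iff.1 hg).toLp _

theorem inner_toL2_toL2 {n : ℕ} {Ω : Set (Pt n)} {g h : Pt n → Cl n} (hg : MemL2 Ω g)
    (hh : MemL2 Ω h) : inner ℝ hg.toL2 hh.toL2 = ∫ x in Ω, ip n (g x) (h x) := by
  rw [L2.inner_def]
  refine integral_congr_ae ?_
  filter_upwards [(memL2_iff.1 hg).coeFn_toLp, (memL2_iff.1 hh).coeFn_toLp] with x h1 h2
  rw [MemL2.toL2, MemL2.toL2, h1, h2, ip_eq_inner]

theorem norm_toL2_sq {n : ℕ} {Ω : Set (Pt n)} {g : Pt n → Cl n} (hg : MemL2 Ω g) :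
    ‖hg.toL2‖ ^ 2 = ∫ x in Ω, ip n (g x) (g x) := by
  rw [← real_inner_self_eq_norm_sq, inner_toL2_toL2]

theorem norm0_sq {n : ℕ} (a : Cl n) : norm0 a ^ 2 = 2 ^ n * ip n a a := by
  rw [norm0, Real.sq_sqrt (by positivity), ip_eq_sum]
  simp_rw [pow_two]

theorem integral_norm0_sq {n : ℕ} {Ω : Set (Pt n)} {g : Pt n → Cl n} (hg : MemL2 Ω g) :
    ∫ x in Ω, norm0 (g x) ^ 2 = 2 ^ n * ‖hg.toL2‖ ^ 2 := by
  simp_rw [norm0_sq, integral_const_mul, norm_toL2_sq]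

theorem coef_star {n : ℕ} (A : Finset (Fin n)) :
    ∃ ε : ℝ, ε * ε = 1 ∧ ∀ a : Cl n, coef A (star a) = ε * coef A a := by
  obtain ⟨ε, hε, h⟩ := star_blade A
  refine ⟨ε, hε, fun a => ?_⟩
  rw [← ip_blade_left, ← ip_star_star, star_star, h, map_smul, LinearMap.smul_apply,
    ip_blade_left, smul_eq_mul]

theorem MemL2.star {n : ℕ} {Ω : Set (Pt n)} {g : Pt n → Cl n} (hg : MemL2 Ω g) :
    MemL2 Ω fun x => star (g x) := by
  intro A
  obtain ⟨ε, -, h⟩ := coef_star (n := n) A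
  simp_rw [h]
  exact (hg A).const_mul ε

theorem norm_toL2_star {n : ℕ} {Ω : Set (Pt n)} {g : Pt n → Cl n} (hg : MemL2 Ω g) :
    ‖hg.star.toL2‖ = ‖hg.toL2‖ := by
  refine (sq_eq_sq₀ (norm_nonneg _) (norm_nonneg _)).1 ?_
  simp_rw [norm_toL2_sq, ip_star_star]

theorem coef_mul {n : ℕ} (A : Finset (Fin n)) (a b : Cl n) :
    coef A (a * b) = ∑ B, ∑ C, coef B a * coef C b * coef A (blade n B * blade n C) := by
  conv_lhs => rw [← sum_coef_smul_blade a, ← sum_coef_smul_blade b]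
  simp only [Finset.sum_mul_sum, smul_mul_smul_comm, coef_sum, coef_smul]

theorem integrable_coef_mul {n : ℕ} {Ω : Set (Pt n)} {g h : Pt n → Cl n} (hg : MemL2 Ω g)
    (hh : MemL2 Ω h) (A : Finset (Fin n)) :
    Integrable (fun x => coef A (g x * h x)) (volume.restrict Ω) := by
  simp only [funext fun x => coef_mul A (g x) (h x)]
  exact integrable_finsetSum _ fun B _ => integrable_finsetSum _ fun C _ =>
    ((hg B).integrable_mul (hh C)).mul_const _

theorem coef_empty_mul_integralOn {n : ℕ} {Ω : Set (Pt n)} {g : Pt n → Cl n}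
    (hg : ∀ A, Integrable (fun x => coef A (g x)) (volume.restrict Ω)) (c : Cl n) :
    coef ∅ (c * integralOn Ω g) = ∫ x in Ω, coef ∅ (c * g x) := by
  have h (a : Cl n) : coef ∅ (c * a) = ∑ A, coef A a * coef ∅ (c * blade n A) := by
    conv_lhs => rw [← sum_coef_smul_blade a]
    simp only [Finset.mul_sum, mul_smul_comm, coef_sum, coef_smul]
  simp_rw [h (g _)]
  rw [integral_finsetSum _ fun A _ => (hg A).mul_const _, integralOn]
  simp only [Finset.mul_sum, mul_smul_comm, coef_sum, coef_smul, integral_mul_const]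

/-! ### Test functions and the Dirac operator acting from the right -/

theorem IsTestFunction.of_coef_eq_sum {n : ℕ} {Ω : Set (Pt n)} {α β : Pt n → Cl n}
    (hα : IsTestFunction Ω α) {m : Finset (Fin n) → Finset (Fin n) → ℝ}
    (h : ∀ A x, coef A (β x) = ∑ B, m A B * coef B (α x)) : IsTestFunction Ω β := by
  intro A
  have hsub : tsupport (fun x => coef A (β x)) ⊆ ⋃ B, tsupport fun x => coef B (α x) := by
    refine closure_minimal (fun x hx => ?_) (isClosed_iUnion_of_finite fun B => isClosed_tsupport _)
    by_contra hx'
    simp only [Set.mem_iUnion, not_exists] at hx'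
    refine hx ?_
    change coef A (β x) = 0
    rw [h]
    exact Finset.sum_eq_zero fun B _ => by
      rw [image_eq_zero_of_notMem_tsupport (hx' B), mul_zero]
  refine ⟨?_, ?_, hsub.trans (Set.iUnion_subset fun B => (hα B).2.2)⟩
  · simp_rw [h]
    exact ContDiff.sum fun B _ => contDiff_const.mul (hα B).1
  · exact (isCompact_iUnion fun B => (hα B).2.1).of_isClosed_subset (isClosed_tsupport _) hsub

theorem coef_mul_left {n : ℕ} (c : Cl n) (A : Finset (Fin n)) (a : Cl n) :
    coef A (c * a) = ∑ B, coef A (c * blade n B) * coef B a := by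
  conv_lhs => rw [← sum_coef_smul_blade a]
  simp only [Finset.mul_sum, mul_smul_comm, coef_sum, coef_smul, mul_comm]

theorem IsTestFunction.const_mul {n : ℕ} {Ω : Set (Pt n)} {α : Pt n → Cl n}
    (hα : IsTestFunction Ω α) (c : Cl n) : IsTestFunction Ω fun x => c * α x :=
  hα.of_coef_eq_sum fun A x => coef_mul_left c A (α x)

/-- The space `C₀^∞(Ω, 𝒜)` of test functions. -/
def testFunctions {n : ℕ} (Ω : Set (Pt n)) : Submodule ℝ (Pt n → Cl n) where
  carrier := {α | IsTestFunction Ω α}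
  add_mem' {α β} hα hβ A := by
    simp only [Pi.add_apply, coef_add]
    exact ⟨(hα A).1.add (hβ A).1, (hα A).2.1.add (hβ A).2.1,
      (tsupport_add _ _).trans (Set.union_subset (hα A).2.2 (hβ A).2.2)⟩
  zero_mem' A := by
    simp only [Pi.zero_apply, coef_zero]
    exact ⟨contDiff_const, HasCompactSupport.zero, by simp [tsupport]⟩
  smul_mem' r α hα := by
    refine hα.of_coef_eq_sum (m := fun A B => if A = B then r else 0) fun A x => ?_
    simp [coef_smul]

/-- The partial derivative `∂α/∂x_i`, taken componentwise. -/
def partialCl {n : ℕ} (i : Fin (n + 1)) (α : Pt n → Cl n) (x : Pt n) : Cl n :=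
  ∑ A, partialDeriv i (fun y => coef A (α y)) x • blade n A

theorem rightDirac_eq_sum {n : ℕ} (α : Pt n → Cl n) (x : Pt n) :
    rightDirac α x = ∑ i, partialCl i α x * eVec n i := by
  simp [rightDirac, partialCl, Finset.sum_mul]

theorem partialCl_add {n : ℕ} {Ω : Set (Pt n)} (i : Fin (n + 1)) {α β : Pt n → Cl n}
    (hα : IsTestFunction Ω α) (hβ : IsTestFunction Ω β) (x : Pt n) :
    partialCl i (α + β) x = partialCl i α x + partialCl i β x := by
  simp only [partialCl, Pi.add_apply, coef_add, partialDeriv_add i (hα _).1 (hβ _).1, add_smul,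
    Finset.sum_add_distrib]

theorem partialCl_smul {n : ℕ} {Ω : Set (Pt n)} (i : Fin (n + 1)) {α : Pt n → Cl n}
    (hα : IsTestFunction Ω α) (r : ℝ) (x : Pt n) :
    partialCl i (r • α) x = r • partialCl i α x := by
  simp only [partialCl, Pi.smul_apply, coef_smul, partialDeriv_const_mul i (hα _).1, mul_smul,
    Finset.smul_sum]

theorem coef_partialCl {n : ℕ} (i : Fin (n + 1)) (α : Pt n → Cl n) (x : Pt n)
    (A : Finset (Fin n)) :
    coef A (partialCl i α x) = partialDeriv i (fun y => coef A (α y)) x := by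
  simp [partialCl, coef_sum, coef_smul, coef_blade]

theorem partialCl_const_mul {n : ℕ} {Ω : Set (Pt n)} (i : Fin (n + 1)) {α : Pt n → Cl n}
    (hα : IsTestFunction Ω α) (c : Cl n) (x : Pt n) :
    partialCl i (fun y => c * α y) x = c * partialCl i α x := by
  rw [← sum_coef_smul_blade (c * partialCl i α x), partialCl]
  refine Finset.sum_congr rfl fun A _ => ?_
  rw [coef_mul_left c A]
  simp only [coef_partialCl, funext fun y => coef_mul_left c A (α y)]
  rw [partialDeriv_sum i _ fun B _ => contDiff_const.mul (hα B).1]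
  simp_rw [partialDeriv_const_mul i (hα _).1]

theorem rightDirac_const_mul {n : ℕ} {Ω : Set (Pt n)} {α : Pt n → Cl n}
    (hα : IsTestFunction Ω α) (c : Cl n) (x : Pt n) :
    rightDirac (fun y => c * α y) x = c * rightDirac α x := by
  simp only [rightDirac_eq_sum, partialCl_const_mul _ hα, Finset.mul_sum, mul_assoc]

theorem IsTestFunction.partialCl {n : ℕ} {Ω : Set (Pt n)} {α : Pt n → Cl n}
    (hα : IsTestFunction Ω α) (i : Fin (n + 1)) : IsTestFunction Ω (partialCl i α) := by
  intro A
  simp_rw [coef_partialCl]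
  exact ⟨contDiff_partialDeriv i (hα A).1, hasCompactSupport_partialDeriv i (hα A).2.1,
    (closure_minimal (support_partialDeriv_subset i _) (isClosed_tsupport _)).trans (hα A).2.2⟩

theorem IsTestFunction.mul_const {n : ℕ} {Ω : Set (Pt n)} {α : Pt n → Cl n}
    (hα : IsTestFunction Ω α) (c : Cl n) : IsTestFunction Ω fun x => α x * c := by
  refine hα.of_coef_eq_sum (m := fun A B => coef A (blade n B * c)) fun A x => ?_
  conv_lhs => rw [← sum_coef_smul_blade (α x)]
  simp only [Finset.sum_mul, smul_mul_assoc, coef_sum, coef_smul, mul_comm]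

theorem IsTestFunction.rightDirac {n : ℕ} {Ω : Set (Pt n)} {α : Pt n → Cl n}
    (hα : IsTestFunction Ω α) : IsTestFunction Ω (rightDirac α) := by
  have h : CliffordDirac.rightDirac α = ∑ i, fun x => CliffordDirac.partialCl i α x * eVec n i := by
    funext x
    simp [rightDirac_eq_sum]
  rw [h]
  exact (testFunctions Ω).sum_mem fun i _ => (hα.partialCl i).mul_const _

theorem IsTestFunction.memL2 {n : ℕ} {Ω : Set (Pt n)} {α : Pt n → Cl n}
    (hα : IsTestFunction Ω α) : MemL2 Ω α :=
  fun A => ((hα A).1.continuous.memLp_of_hasCompactSupport (hα A).2.1).restrict Ω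

/-- The embedding of the test functions into `L²`. -/
def testToL2 {n : ℕ} (Ω : Set (Pt n)) : testFunctions Ω →ₗ[ℝ]
    Lp (EuclideanSpace ℝ (Finset (Fin n))) 2 (volume.restrict Ω) where
  toFun α := (IsTestFunction.memL2 α.2).toL2
  map_add' α β := by
    simp only [MemL2.toL2, ← MemLp.toLp_add]
    congr 1
    funext x
    simp
  map_smul' r α := by
    simp only [MemL2.toL2, RingHom.id_apply, ← MemLp.toLp_const_smul]
    congr 1
    funext x
    simp

/-- The operator `α ↦ α D̄` on test functions. -/
def testDirac {n : ℕ} (Ω : Set (Pt n)) : testFunctions Ω →ₗ[ℝ] testFunctions Ω where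
  toFun α := ⟨rightDirac α.1, IsTestFunction.rightDirac α.2⟩
  map_add' α β := by
    ext1
    funext x
    simp [rightDirac_eq_sum, partialCl_add _ α.2 β.2, add_mul, Finset.sum_add_distrib]
  map_smul' r α := by
    ext1
    funext x
    simp [rightDirac_eq_sum, partialCl_smul _ α.2, Finset.smul_sum]

theorem IsTestFunction.setIntegral_ip {n : ℕ} {Ω : Set (Pt n)} {α : Pt n → Cl n}
    (hα : IsTestFunction Ω α) (β : Pt n → Cl n) :
    ∫ x in Ω, ip n (α x) (β x) = ∫ x, ip n (α x) (β x) := by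
  refine setIntegral_eq_integral_of_forall_compl_eq_zero fun x hx => ?_
  rw [ip_eq_sum]
  refine Finset.sum_eq_zero fun A _ => ?_
  have : coef A (α x) = 0 :=
    image_eq_zero_of_notMem_tsupport (f := fun x => coef A (α x)) fun h => hx ((hα A).2.2 h)
  rw [this, zero_mul]

theorem IsTestFunction.integrable_coef_mul_coef {n : ℕ} {Ω : Set (Pt n)} {α β : Pt n → Cl n}
    (hα : IsTestFunction Ω α) (hβ : IsTestFunction Ω β) (A B : Finset (Fin n)) :
    Integrable fun x => coef A (α x) * coef B (β x) :=
  ((hα A).1.continuous.mul (hβ B).1.continuous).integrable_of_hasCompactSupport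
    (hβ B).2.1.mul_left

theorem IsTestFunction.integrable_ip {n : ℕ} {Ω : Set (Pt n)} {α β : Pt n → Cl n}
    (hα : IsTestFunction Ω α) (hβ : IsTestFunction Ω β) :
    Integrable fun x => ip n (α x) (β x) := by
  simp_rw [ip_eq_sum]
  exact integrable_finsetSum _ fun A _ => hα.integrable_coef_mul_coef hβ A A

theorem IsTestFunction.integral_ip_mul {n : ℕ} {Ω : Set (Pt n)} {α β : Pt n → Cl n}
    (hα : IsTestFunction Ω α) (hβ : IsTestFunction Ω β) (c d : Cl n) :
    ∫ x, ip n (α x * c) (β x * d) = ∑ A, ∑ B, ip n (blade n A * c) (blade n B * d) *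
      ∫ x, coef A (α x) * coef B (β x) := by
  have h (a b : Cl n) : ip n (a * c) (b * d) = ∑ A, ∑ B, ip n (blade n A * c) (blade n B * d) *
      (coef A a * coef B b) := by
    conv_lhs => rw [← sum_coef_smul_blade a, ← sum_coef_smul_blade b]
    simp only [Finset.sum_mul, smul_mul_assoc, map_sum, map_smul, LinearMap.sum_apply,
      LinearMap.smul_apply, smul_eq_mul]
    simp only [Finset.mul_sum]
    rw [Finset.sum_comm]
    exact Finset.sum_congr rfl fun A _ => Finset.sum_congr rfl fun B _ => by ring
  simp only [funext fun x => h (α x) (β x)]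
  have hi (A B : Finset (Fin n)) := (hα.integrable_coef_mul_coef hβ A B).const_mul
    (ip n (blade n A * c) (blade n B * d))
  rw [integral_finsetSum _ fun A _ => integrable_finsetSum _ fun B _ => hi A B]
  refine Finset.sum_congr rfl fun A _ => ?_
  rw [integral_finsetSum _ fun B _ => hi A B]
  simp_rw [integral_const_mul]

/-- The mixed terms in the energy of `α D̄` integrate to zero. -/
theorem integral_ip_partialCl_eq_zero {n : ℕ} {Ω : Set (Pt n)} {α : Pt n → Cl n}
    (hα : IsTestFunction Ω α) {i j : Fin (n + 1)} (hij : i ≠ j) :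
    ∫ x, ip n (partialCl i α x * eVec n i) (partialCl j α x * eVec n j) = 0 := by
  have h1 : ∫ x, ip n (partialCl i α x * eVec n i) (partialCl j α x * eVec n j) =
      ∫ x, ip n (partialCl j α x * eVec n i) (partialCl i α x * eVec n j) := by
    rw [(hα.partialCl i).integral_ip_mul (hα.partialCl j),
      (hα.partialCl j).integral_ip_mul (hα.partialCl i)]
    simp_rw [coef_partialCl]
    simp_rw [integral_partialDeriv_mul_partialDeriv_swap i j (hα _).1 (hα _).1 (hα _).2.1]
  have h2 (x : Pt n) : ip n (partialCl j α x * eVec n i) (partialCl i α x * eVec n j) =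
      -ip n (partialCl i α x * eVec n i) (partialCl j α x * eVec n j) := by
    rw [ip_mul_eVec_swap hij, ip_comm]
  simp_rw [h2, integral_neg] at h1
  linarith

/-- The energy identity `‖α D̄‖² = ∑ i, ‖∂α/∂x_i‖²`. -/
theorem integral_ip_rightDirac {n : ℕ} {Ω : Set (Pt n)} {α : Pt n → Cl n}
    (hα : IsTestFunction Ω α) :
    ∫ x, ip n (rightDirac α x) (rightDirac α x) =
      ∑ i, ∫ x, ip n (partialCl i α x) (partialCl i α x) := by
  have hi (i j : Fin (n + 1)) : Integrable fun x =>
      ip n (partialCl i α x * eVec n i) (partialCl j α x * eVec n j) :=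
    ((hα.partialCl i).mul_const _).integrable_ip ((hα.partialCl j).mul_const _)
  simp_rw [rightDirac_eq_sum, map_sum, LinearMap.sum_apply]
  rw [integral_finsetSum _ fun j _ => integrable_finsetSum _ fun i _ => hi i j]
  refine Finset.sum_congr rfl fun j _ => ?_
  rw [integral_finsetSum _ fun i _ => hi i j, Finset.sum_eq_single j]
  · simp_rw [ip_mul_eVec_self]
  · exact fun i _ hij => integral_ip_partialCl_eq_zero hα hij
  · simp

theorem ip_self_nonneg {n : ℕ} (a : Cl n) : 0 ≤ ip n a a := by
  rw [ip_eq_inner]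
  exact real_inner_self_nonneg

theorem IsTestFunction.integral_ip_self_le {n : ℕ} {Ω : Set (Pt n)} {a b : ℝ}
    (hΩ : Ω ⊆ slab n a b) {α : Pt n → Cl n} (hα : IsTestFunction Ω α) :
    ∫ x, ip n (α x) (α x) ≤
      (2 * (b - a)) ^ 2 * ∫ x, ip n (CliffordDirac.rightDirac α x)
        (CliffordDirac.rightDirac α x) := by
  have h0 : ∫ x, ip n (CliffordDirac.partialCl 0 α x) (CliffordDirac.partialCl 0 α x) ≤
      ∫ x, ip n (CliffordDirac.rightDirac α x) (CliffordDirac.rightDirac α x) := by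
    rw [integral_ip_rightDirac hα]
    exact Finset.single_le_sum
      (f := fun i => ∫ x, ip n (CliffordDirac.partialCl i α x) (CliffordDirac.partialCl i α x))
      (fun i _ => integral_nonneg fun x => ip_self_nonneg _) (Finset.mem_univ 0)
  refine le_trans ?_ (mul_le_mul_of_nonneg_left h0 (sq_nonneg _))
  simp_rw [ip_eq_sum]
  have hα' := hα.partialCl 0
  rw [integral_finsetSum _ fun A _ => hα.integrable_coef_mul_coef hα A A,
    integral_finsetSum _ fun A _ => hα'.integrable_coef_mul_coef hα' A A, Finset.mul_sum]
  refine Finset.sum_le_sum fun A _ => ?_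
  simp_rw [coef_partialCl, ← pow_two]
  exact integral_sq_le_of_tsupport_subset_slab (hα A).1 (hα A).2.1 ((hα A).2.2.trans hΩ)

theorem norm_testToL2_le {n : ℕ} {Ω : Set (Pt n)} {a b : ℝ} (hab : a ≤ b)
    (hΩ : Ω ⊆ slab n a b) (α : testFunctions Ω) :
    ‖testToL2 Ω α‖ ≤ 2 * (b - a) * ‖testToL2 Ω (testDirac Ω α)‖ := by
  have h0 : 0 ≤ 2 * (b - a) := by linarith
  refine (sq_le_sq₀ (norm_nonneg _) (by positivity)).1 ?_
  rw [mul_pow]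
  change ‖(IsTestFunction.memL2 α.2).toL2‖ ^ 2 ≤
    _ * ‖(IsTestFunction.memL2 (testDirac Ω α).2).toL2‖ ^ 2
  rw [norm_toL2_sq, norm_toL2_sq, IsTestFunction.setIntegral_ip α.2,
    IsTestFunction.setIntegral_ip (testDirac Ω α).2]
  exact IsTestFunction.integral_ip_self_le hΩ α.2

/-! ### Weak solutions -/

/-- The weak equation follows from its scalar parts. -/
theorem isWeakSolution_of_setIntegral_ip {n : ℕ} {Ω : Set (Pt n)} {u f : Pt n → Cl n}
    (hu : MemL2 Ω u) (hf : MemL2 Ω f)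
    (h : ∀ α, IsTestFunction Ω α → ∫ x in Ω, ip n (rightDirac α x) (star (u x)) =
      -∫ x in Ω, ip n (α x) (star (f x))) : IsWeakSolution Ω u f := by
  intro α hα
  rw [← sub_eq_zero, sub_neg_eq_add]
  refine eq_zero_of_coef_empty_blade_mul fun B => ?_
  rw [mul_add, coef_add, coef_empty_mul_integralOn (integrable_coef_mul hα.memL2 hf),
    coef_empty_mul_integralOn (integrable_coef_mul hα.rightDirac.memL2 hu)]
  have h' := h _ (hα.const_mul (blade n B))
  simp_rw [rightDirac_const_mul hα] at h'
  simp_rw [← mul_assoc, coef_empty_mul]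
  linarith

theorem exists_memL2_of_Lp {n : ℕ} {Ω : Set (Pt n)}
    (v : Lp (EuclideanSpace ℝ (Finset (Fin n))) 2 (volume.restrict Ω)) :
    ∃ (g : Pt n → Cl n) (hg : MemL2 Ω g), hg.toL2 = v := by
  have hg : MemL2 Ω fun x => (coords n).symm (v x) :=
    memL2_iff.2 (by simpa using Lp.memLp v)
  refine ⟨_, hg, ?_⟩
  simp only [MemL2.toL2, LinearEquiv.apply_symm_apply]
  exact Lp.toLp_coeFn v _

/-- Existence of weak solutions on subsets of a slab, with a bound that does not involve `n`. -/
theorem exists_isWeakSolution_of_subset_slab {n : ℕ} {Ω : Set (Pt n)} {a b : ℝ} (hab : a ≤ b)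
    (hΩ : Ω ⊆ slab n a b) {f : Pt n → Cl n} (hf : MemL2 Ω f) :
    ∃ u : Pt n → Cl n, MemL2 Ω u ∧ IsWeakSolution Ω u f ∧
      ∫ x in Ω, norm0 (u x) ^ 2 ≤ (2 * (b - a)) ^ 2 * ∫ x in Ω, norm0 (f x) ^ 2 := by
  obtain ⟨v, hvn, hv⟩ := exists_inner_eq_neg_inner_of_norm_le (testToL2 Ω)
    (testToL2 Ω ∘ₗ testDirac Ω) (by linarith) (norm_testToL2_le hab hΩ) hf.star.toL2
  obtain ⟨g, hg, rfl⟩ := exists_memL2_of_Lp v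
  refine ⟨fun x => star (g x), hg.star, isWeakSolution_of_setIntegral_ip hg.star hf ?_, ?_⟩
  · intro α hα
    simp_rw [star_star]
    rw [← inner_toL2_toL2 hα.rightDirac.memL2 hg, ← inner_toL2_toL2 hα.memL2 hf.star]
    exact hv ⟨α, hα⟩
  · rw [integral_norm0_sq hg.star, integral_norm0_sq hf, norm_toL2_star hg]
    rw [norm_toL2_star hf] at hvn
    have := pow_le_pow_left₀ (norm_nonneg _) hvn 2
    rw [mul_pow] at this
    calc (2 : ℝ) ^ n * ‖hg.toL2‖ ^ 2
        ≤ 2 ^ n * ((2 * (b - a)) ^ 2 * ‖hf.toL2‖ ^ 2) := by gcongr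
      _ = _ := by ring

theorem exists_subset_slab {n : ℕ} {Ω : Set (Pt n)} (hΩ : Bornology.IsBounded Ω) :
    ∃ R : ℝ, 0 ≤ R ∧ Ω ⊆ slab n (-R) R := by
  obtain ⟨R, hR, h⟩ := hΩ.exists_pos_norm_le
  refine ⟨R, hR.le, fun x hx => abs_le.1 ?_⟩
  exact (PiLp.norm_apply_le x 0).trans (h x hx)

end CliffordDirac

end

theorem theorem16 :
    (∀ a b : ℝ, a < b → ∃ c : ℝ, 0 < c ∧
      ∀ (n : ℕ) (f : Pt n → Cl n), MemL2 (slab n a b) f →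
        ∃ u : Pt n → Cl n, MemL2 (slab n a b) u ∧ IsWeakSolution (slab n a b) u f ∧
          (∫ x in slab n a b, norm0 (u x) ^ 2) ≤
            2 ^ (2 * n) * c * (∫ x in slab n a b, norm0 (f x) ^ 2)) ∧
    (∀ (n : ℕ) (Ω : Set (Pt n)), IsOpen Ω → Bornology.IsBounded Ω →
      ∀ f : Pt n → Cl n, MemL2 Ω f →
        ∃ u : Pt n → Cl n, MemL2 Ω u ∧ IsWeakSolution Ω u f) := by
  refine ⟨fun a b hab => ⟨(2 * (b - a)) ^ 2, ?_, fun n f hf => ?_⟩, fun n Ω _ hΩ f hf => ?_⟩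
  · have : 0 < b - a := sub_pos.2 hab
    positivity
  · obtain ⟨u, hu, hw, hle⟩ := exists_isWeakSolution_of_subset_slab hab.le subset_rfl hf
    refine ⟨u, hu, hw, hle.trans ?_⟩
    have h0 : 0 ≤ ∫ x in slab n a b, norm0 (f x) ^ 2 := integral_nonneg fun x => sq_nonneg _
    rw [mul_assoc]
    exact le_mul_of_one_le_left (by positivity) (one_le_pow₀ (by norm_num))
  · obtain ⟨R, hR, hsub⟩ := exists_subset_slab hΩ
    obtain ⟨u, hu, hw, -⟩ := exists_isWeakSolution_of_subset_slab (by linarith) hsub hf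
    exact ⟨u, hu, hw⟩
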